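/- Let $p$ be a prime. For a pro-$p$ group $\Delta$ let $\Delta^{(n)}$ denote its descending $p$-central series: $\Delta^{(1)}=\Delta$, and $\Delta^{(n+1)}$ is the closed subgroup generated by the $p$-th powers of elements of $\Delta^{(n)}$ and the commutators $[\Delta^{(n)},\Delta]$. Let $H^2(\Delta,\mathbb{F}_p)^{\mathrm{dec}}\subseteq H^2(\Delta,\mathbb{F}_p)$ denote the subgroup of continuous cohomology generated by the cup products of elements of $H^1(\Delta,\mathbb{F}_p)$. Let $\Gamma$ and $H$ be pro-$p$ groups with maximal closed subgroups $\Delta$ and $N$, respectively (that is, maximal among the proper closed subgroups; they are automatically normal), and let $\alpha\colon\Gamma\to H$ be a continuous surjective homomorphism with $\alpha(\Delta)=N$ and $\ker\alpha\subseteq\Delta^{(3)}$. Write $G=\Gamma/\Delta$, which $\alpha$ identifies with $H/N$. Then $H^2(\Delta,\mathbb{F}_p)^{\mathrm{dec}}\cong H^2(N,\mathbb{F}_p)^{\mathrm{dec}}$ as $\mathbb{F}_pG$-modules, where $\Gamma/\Delta$ and $H/N$ act on the cohomology of $\Delta$ and $N$ by conjugation. -/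

import Mathlib

universe u

namespace ModPCohomology

open CategoryTheory TopRep

/-- The discrete coefficient module `𝔽_p`, placed in the universe of the group. -/
abbrev Fp (p : ℕ) : Type u := ULift.{u} (ZMod p)

instance (p : ℕ) : ContinuousSMul (ZMod p) (Fp.{u} p) :=
  ⟨continuous_of_discreteTopology⟩

/-- `𝔽_p` with the trivial action of `G`. -/
noncomputable abbrev triv (p : ℕ) (G : Type u) [Group G] : TopRep.{u} (ZMod p) G :=
  TopRep.of (ContRepresentation.trivial (ZMod p) G (Fp.{u} p))

section Group

variable (p : ℕ) (G : Type u) [Group G] [TopologicalSpace G] [IsTopologicalGroup G]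

/-- The complex of homogeneous continuous cochains of `G` with coefficients in `𝔽_p`. -/
noncomputable abbrev cochains : CochainComplex (TopModuleCat.{u} (ZMod p)) ℕ :=
  homogeneousCochains (triv p G)

/-- Continuous cohomology `H^n(G, 𝔽_p)`. -/
noncomputable abbrev H (n : ℕ) : TopModuleCat.{u} (ZMod p) :=
  continuousCohomology n (triv p G)

/-- Homogeneous continuous `n`-cocycles with values in `𝔽_p`. -/
noncomputable abbrev Z (n : ℕ) : TopModuleCat.{u} (ZMod p) :=
  ContinuousCohomology.cocycles (triv p G) n

variable {p G}

/-- The function of two variables underlying a homogeneous 1-cochain. -/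
def val₁ (f : (cochains p G).X 1) : C(G, C(G, Fp.{u} p)) := f.1

/-- The function of three variables underlying a homogeneous 2-cochain. -/
def val₂ (f : (cochains p G).X 2) : C(G, C(G, C(G, Fp.{u} p))) := f.1

theorem val₁_inv (f : (cochains p G).X 1) (g x y : G) :
    val₁ f (g * x) (g * y) = val₁ f x y := by
  have h := congr($(f.2 g⁻¹) x y)
  change val₁ f (g⁻¹⁻¹ * x) (g⁻¹⁻¹ * y) = val₁ f x y at h
  rwa [inv_inv] at h

theorem val₂_inv (f : (cochains p G).X 2) (g x y z : G) :
    val₂ f (g * x) (g * y) (g * z) = val₂ f x y z := by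
  have h := congr($(f.2 g⁻¹) x y z)
  change val₂ f (g⁻¹⁻¹ * x) (g⁻¹⁻¹ * y) (g⁻¹⁻¹ * z) = val₂ f x y z at h
  rwa [inv_inv] at h

theorem ext₂ {f f' : (cochains p G).X 2} (h : ∀ x y z, val₂ f x y z = val₂ f' x y z) :
    f = f' :=
  Subtype.ext (ContinuousMap.ext fun x => ContinuousMap.ext fun y => ContinuousMap.ext (h x y))

theorem val₂_add (f f' : (cochains p G).X 2) (x y z : G) :
    val₂ (f + f') x y z = val₂ f x y z + val₂ f' x y z := rfl

theorem val₂_smul (c : ZMod p) (f : (cochains p G).X 2) (x y z : G) :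
    val₂ (c • f) x y z = c • val₂ f x y z := rfl

theorem val₂_sub (f f' : (cochains p G).X 2) (x y z : G) :
    val₂ (f - f') x y z = val₂ f x y z - val₂ f' x y z := rfl

/-- A homogeneous 1-cochain from an invariant continuous function of two variables. -/
noncomputable def mk₁ (f : G → G → Fp.{u} p) (hf : Continuous fun x : G × G => f x.1 x.2)
    (hinv : ∀ g x y, f (g * x) (g * y) = f x y) : (cochains p G).X 1 :=
  ⟨ContinuousMap.curry ⟨fun x : G × G => f x.1 x.2, hf⟩, fun g =>
    ContinuousMap.ext fun x => ContinuousMap.ext fun y => hinv g⁻¹ x y⟩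

/-- A homogeneous 2-cochain from an invariant continuous function of three variables. -/
noncomputable def mk₂ (f : G → G → G → Fp.{u} p) (hf : Continuous fun x : (G × G) × G => f x.1.1 x.1.2 x.2)
    (hinv : ∀ g x y z, f (g * x) (g * y) (g * z) = f x y z) : (cochains p G).X 2 :=
  ⟨ContinuousMap.curry (ContinuousMap.curry ⟨fun x : (G × G) × G => f x.1.1 x.1.2 x.2, hf⟩),
    fun g => ContinuousMap.ext fun x => ContinuousMap.ext fun y => ContinuousMap.ext fun z =>
      hinv g⁻¹ x y z⟩

theorem d₀_apply (f : (cochains p G).X 0) : ((cochains p G).d 0 1).hom f = 0 := by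
  apply Subtype.ext
  rw [homogeneousCochains.d_apply]
  refine ContinuousMap.ext fun x => ContinuousMap.ext fun y => ?_
  have h : (f.1 : C(G, Fp.{u} p)) (x⁻¹⁻¹ * 1) = (f.1 : C(G, Fp.{u} p)) 1 := congr($(f.2 x⁻¹) 1)
  have h' : (f.1 : C(G, Fp.{u} p)) (y⁻¹⁻¹ * 1) = (f.1 : C(G, Fp.{u} p)) 1 := congr($(f.2 y⁻¹) 1)
  simp only [inv_inv, mul_one] at h h'
  change (f.1 : C(G, Fp.{u} p)) y - (f.1 : C(G, Fp.{u} p)) x = 0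
  rw [h, h', sub_self]

theorem d₁_apply (f : (cochains p G).X 1) (x y z : G) :
    val₂ (((cochains p G).d 1 2).hom f) x y z =
      val₁ f y z - (val₁ f x z - val₁ f x y) := by
  unfold val₂
  rw [homogeneousCochains.d_apply]
  rfl

theorem d₂_apply (f : (cochains p G).X 2) (x y z w : G) :
    (show C(G, C(G, C(G, C(G, Fp.{u} p)))) from (((cochains p G).d 2 3).hom f).1) x y z w =
      val₂ f y z w - (val₂ f x z w - (val₂ f x y w - val₂ f x y z)) := by
  rw [homogeneousCochains.d_apply]
  rfl

/-- The cocycle determined by a cochain with vanishing differential. -/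
noncomputable def mkZ {n : ℕ} (f : (cochains p G).X n)
    (hf : ((cochains p G).d n (n + 1)).hom f = 0) : Z p G n :=
  ((cochains p G).liftCycles (TopModuleCat.kerι ((cochains p G).d n (n + 1))) (n + 1) (by simp)
    (TopModuleCat.kerι_comp _)).hom ⟨f, hf⟩

/-- The cochain underlying a cocycle. -/
noncomputable def cochain {n : ℕ} (z : Z p G n) : (cochains p G).X n :=
  ((cochains p G).iCycles n).hom z

theorem cochain_mkZ {n : ℕ} (f : (cochains p G).X n)
    (hf : ((cochains p G).d n (n + 1)).hom f = 0) : cochain (mkZ f hf) = f :=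
  ConcreteCategory.congr_hom ((cochains p G).liftCycles_i
    (TopModuleCat.kerι ((cochains p G).d n (n + 1))) (n + 1) (by simp)
    (TopModuleCat.kerι_comp _)) (⟨f, hf⟩ : TopModuleCat.ker ((cochains p G).d n (n + 1)))

theorem d_cochain {n : ℕ} (z : Z p G n) :
    ((cochains p G).d n (n + 1)).hom (cochain z) = 0 :=
  ConcreteCategory.congr_hom ((cochains p G).iCycles_d n (n + 1)) z

theorem cochain_injective {n : ℕ} :
    Function.Injective (cochain : Z p G n → (cochains p G).X n) := by
  let e := ((cochains p G).cyclesIsKernel n (n + 1) (by simp)).conePointUniqueUpToIso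
    (TopModuleCat.isLimitKer ((cochains p G).d n (n + 1)))
  have he : e.hom ≫ TopModuleCat.kerι _ = (cochains p G).iCycles n :=
    ((cochains p G).cyclesIsKernel n (n + 1) (by simp)).conePointUniqueUpToIso_hom_comp
      (TopModuleCat.isLimitKer ((cochains p G).d n (n + 1))) Limits.WalkingParallelPair.zero
  intro z z' h
  have h1 : (TopModuleCat.kerι ((cochains p G).d n (n + 1))).hom (e.hom.hom z) =
      (TopModuleCat.kerι ((cochains p G).d n (n + 1))).hom (e.hom.hom z') := by
    have a := ConcreteCategory.congr_hom he z
    have b := ConcreteCategory.congr_hom he z'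
    exact a.trans (h.trans b.symm)
  have h2 := Subtype.val_injective h1
  have h3 : ∀ w, e.inv.hom (e.hom.hom w) = w := fun w =>
    ConcreteCategory.congr_hom e.hom_inv_id w
  rw [← h3 z, ← h3 z', h2]

theorem cochain_add {n : ℕ} (z z' : Z p G n) : cochain (z + z') = cochain z + cochain z' :=
  map_add ((cochains p G).iCycles n).hom z z'

theorem cochain_smul {n : ℕ} (c : ZMod p) (z : Z p G n) : cochain (c • z) = c • cochain z :=
  map_smul ((cochains p G).iCycles n).hom c z

theorem cochain_sub {n : ℕ} (z z' : Z p G n) : cochain (z - z') = cochain z - cochain z' :=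
  map_sub ((cochains p G).iCycles n).hom z z'

theorem cocycle₁ (z : Z p G 1) (x y w : G) :
    val₁ (cochain z) x w = val₁ (cochain z) x y + val₁ (cochain z) y w := by
  have h := d₁_apply (cochain z) x y w
  rw [d_cochain] at h
  change (0 : Fp.{u} p) = _ at h
  linear_combination h

theorem cocycle₂ (z : Z p G 2) (x y w v : G) :
    val₂ (cochain z) y w v - val₂ (cochain z) x w v + val₂ (cochain z) x y v
      - val₂ (cochain z) x y w = 0 := by
  have h := d₂_apply (cochain z) x y w v
  rw [d_cochain] at h
  change (0 : Fp.{u} p) = _ at h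
  linear_combination -h

/-- The cohomology class of a cocycle. -/
noncomputable def cls (n : ℕ) : Z p G n →ₗ[ZMod p] H p G n :=
  (ContinuousCohomology.π (triv p G) n).hom.toLinearMap

theorem cls_eq_zero {n : ℕ} (z : Z p G (n + 1)) (f : (cochains p G).X n)
    (h : cochain z = ((cochains p G).d n (n + 1)).hom f) : cls (n + 1) z = 0 := by
  have hz : z = ((cochains p G).toCycles n (n + 1)).hom f := by
    apply cochain_injective
    rw [h]
    exact (ConcreteCategory.congr_hom ((cochains p G).toCycles_i n (n + 1)) f).symm
  rw [hz]
  exact ConcreteCategory.congr_hom ((cochains p G).toCycles_comp_homologyπ n (n + 1)) f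

instance : IsIso (ContinuousCohomology.π (triv p G) 1) :=
  (cochains p G).isIso_homologyπ 0 1 (by simp) (by ext f; exact d₀_apply f)

/-- With trivial coefficients there are no nonzero 1-coboundaries, so a class in `H^1` has exactly
one representing cocycle. -/
noncomputable def rep₁ : H p G 1 →ₗ[ZMod p] Z p G 1 :=
  (inv (ContinuousCohomology.π (triv p G) 1)).hom.toLinearMap

theorem cls_rep₁ (a : H p G 1) : cls 1 (rep₁ a) = a :=
  ConcreteCategory.congr_hom (IsIso.inv_hom_id (ContinuousCohomology.π (triv p G) 1)) a

theorem rep₁_cls (z : Z p G 1) : rep₁ (cls 1 z) = z :=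
  ConcreteCategory.congr_hom (IsIso.hom_inv_id (ContinuousCohomology.π (triv p G) 1)) z

variable [CompactSpace G]

/-- The cup product of homogeneous 1-cocycles, as a cochain:
`(f ∪ f')(x, y, z) = f (x, y) * f' (y, z)`. -/
noncomputable def cupCochain (f f' : Z p G 1) : (cochains p G).X 2 :=
  mk₂ (fun x y z => val₁ (cochain f) x y * val₁ (cochain f') y z) (by fun_prop)
    (fun g x y z => by rw [val₁_inv, val₁_inv])

theorem d_cupCochain (f f' : Z p G 1) :
    ((cochains p G).d 2 3).hom (cupCochain f f') = 0 := by
  apply Subtype.ext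
  refine ContinuousMap.ext fun x => ContinuousMap.ext fun y => ContinuousMap.ext fun z =>
    ContinuousMap.ext fun w => ?_
  refine (d₂_apply _ x y z w).trans ?_
  change val₁ (cochain f) y z * val₁ (cochain f') z w
    - (val₁ (cochain f) x z * val₁ (cochain f') z w
    - (val₁ (cochain f) x y * val₁ (cochain f') y w
    - val₁ (cochain f) x y * val₁ (cochain f') y z)) = 0
  rw [cocycle₁ f x y z, cocycle₁ f' y z w]
  ring

/-- The cup product of 1-cocycles, as a 2-cocycle. -/
noncomputable def cupZ (f f' : Z p G 1) : Z p G 2 :=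
  mkZ (cupCochain f f') (d_cupCochain f f')

theorem val₂_cupZ (f f' : Z p G 1) (x y z : G) :
    val₂ (cochain (cupZ f f')) x y z = val₁ (cochain f) x y * val₁ (cochain f') y z := by
  rw [cupZ, cochain_mkZ]
  rfl

/-- The cup product `H^1(G, 𝔽_p) × H^1(G, 𝔽_p) → H^2(G, 𝔽_p)`. -/
noncomputable def cup : H p G 1 →ₗ[ZMod p] H p G 1 →ₗ[ZMod p] H p G 2 :=
  LinearMap.mk₂ (ZMod p) (fun a b => cls 2 (cupZ (rep₁ a) (rep₁ b)))
    (fun a a' b => by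
      rw [← map_add]
      congr 1
      apply cochain_injective
      apply ext₂
      intro x y z
      rw [cochain_add]
      rw [val₂_add]
      rw [val₂_cupZ, val₂_cupZ, val₂_cupZ, map_add, cochain_add]
      exact add_mul _ _ _)
    (fun c a b => by
      rw [← map_smul]
      congr 1
      apply cochain_injective
      apply ext₂
      intro x y z
      rw [cochain_smul]
      rw [val₂_smul]
      rw [val₂_cupZ, val₂_cupZ, map_smul, cochain_smul]
      exact smul_mul_assoc c _ _)
    (fun a b b' => by
      rw [← map_add]
      congr 1
      apply cochain_injective
      apply ext₂
      intro x y z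
      rw [cochain_add]
      rw [val₂_add]
      rw [val₂_cupZ, val₂_cupZ, val₂_cupZ, map_add, cochain_add]
      exact mul_add _ _ _)
    (fun c a b => by
      rw [← map_smul]
      congr 1
      apply cochain_injective
      apply ext₂
      intro x y z
      rw [cochain_smul]
      rw [val₂_smul]
      rw [val₂_cupZ, val₂_cupZ, map_smul, cochain_smul]
      exact mul_smul_comm c _ _)

theorem cup_cls (f f' : Z p G 1) : cup (cls 1 f) (cls 1 f') = cls 2 (cupZ f f') := by
  change cls 2 (cupZ (rep₁ _) (rep₁ _)) = _
  rw [rep₁_cls, rep₁_cls]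

variable (p G) in
/-- The decomposable part `H^2(G, 𝔽_p)^{dec}`: the subgroup generated by the cup products of
elements of `H^1(G, 𝔽_p)`. -/
noncomputable def dec : Submodule (ZMod p) (H p G 2) :=
  Submodule.span (ZMod p) {c | ∃ a b : H p G 1, cup a b = c}

end Group

section Functoriality

variable {p : ℕ} {G G' G'' : Type u}
  [Group G] [TopologicalSpace G] [IsTopologicalGroup G]
  [Group G'] [TopologicalSpace G'] [IsTopologicalGroup G']
  [Group G''] [TopologicalSpace G''] [IsTopologicalGroup G'']

/-- The restriction of `𝔽_p` along a homomorphism is `𝔽_p`. -/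
noncomputable def trivRes (φ : G' →ₜ* G) : res (φ : G' →* G) (triv p G) ⟶ triv p G' :=
  ofHom ⟨ContinuousLinearMap.id (ZMod p) (Fp.{u} p), fun _ => rfl⟩

/-- The map `H^n(G, 𝔽_p) → H^n(G', 𝔽_p)` induced by a continuous homomorphism `G' → G`. -/
noncomputable def pull (φ : G' →ₜ* G) (n : ℕ) : H p G n →ₗ[ZMod p] H p G' n :=
  (ContinuousCohomology.map φ (trivRes φ) n).hom.toLinearMap

/-- The map on cocycles induced by a continuous homomorphism. -/
noncomputable def pullZ (φ : G' →ₜ* G) (n : ℕ) : Z p G n →ₗ[ZMod p] Z p G' n :=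
  (ContinuousCohomology.cocyclesMap φ (trivRes φ) n).hom.toLinearMap

theorem pull_id (n : ℕ) : pull (p := p) (ContinuousMonoidHom.id G) n = LinearMap.id := by
  have h := ContinuousCohomology.map_id (triv p G) n
  ext x
  exact ConcreteCategory.congr_hom h x

theorem pull_comp (φ : G' →ₜ* G) (ψ : G'' →ₜ* G') (n : ℕ) :
    pull (p := p) (φ.comp ψ) n = (pull ψ n).comp (pull φ n) := by
  have h := ContinuousCohomology.map_comp φ ψ (trivRes (p := p) φ) (trivRes ψ) n
  ext x
  exact ConcreteCategory.congr_hom h x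

theorem pull_cls (φ : G' →ₜ* G) (n : ℕ) (z : Z p G n) :
    pull φ n (cls n z) = cls n (pullZ φ n z) :=
  ConcreteCategory.congr_hom (ContinuousCohomology.π_map φ (trivRes (p := p) φ) n) z

set_option maxHeartbeats 1000000 in
theorem cochain_pullZ (φ : G' →ₜ* G) (n : ℕ) (z : Z p G n) :
    cochain (pullZ φ n z) =
      ((ContinuousCohomology.cochainsMap φ (trivRes (p := p) φ)).f n).hom (cochain z) :=
  ConcreteCategory.congr_hom (HomologicalComplex.cyclesMap_i
    (ContinuousCohomology.cochainsMap φ (trivRes (p := p) φ)) n) z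

theorem val₁_pullZ (φ : G' →ₜ* G) (z : Z p G 1) (x y : G') :
    val₁ (cochain (pullZ φ 1 z)) x y = val₁ (cochain z) (φ x) (φ y) := by
  rw [cochain_pullZ]
  rfl

theorem val₂_pullZ (φ : G' →ₜ* G) (z : Z p G 2) (x y w : G') :
    val₂ (cochain (pullZ φ 2 z)) x y w = val₂ (cochain z) (φ x) (φ y) (φ w) := by
  rw [cochain_pullZ]
  rfl

variable [CompactSpace G] [CompactSpace G']

theorem pull_cup (φ : G' →ₜ* G) (a b : H p G 1) :
    pull φ 2 (cup a b) = cup (pull φ 1 a) (pull φ 1 b) := by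
  rw [← cls_rep₁ a, ← cls_rep₁ b, cup_cls, pull_cls, pull_cls, pull_cls, cup_cls]
  congr 1
  apply cochain_injective
  apply ext₂
  intro x y z
  rw [val₂_pullZ, val₂_cupZ, val₂_cupZ, val₁_pullZ, val₁_pullZ]

theorem dec_le_comap_pull (φ : G' →ₜ* G) : dec p G ≤ (dec p G').comap (pull φ 2) := by
  refine Submodule.span_le.2 ?_
  rintro _ ⟨a, b, rfl⟩
  exact Submodule.subset_span ⟨pull φ 1 a, pull φ 1 b, (pull_cup φ a b).symm⟩

/-- Inner automorphisms act trivially on `H^2`. -/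
theorem pull_inner (φ : G →ₜ* G) (d : G) (hφ : ∀ x, φ x = d⁻¹ * x * d) (c : H p G 2) :
    pull φ 2 c = c := by
  have key : ∀ z : Z p G 2, cls 2 (pullZ φ 2 z - z) = 0 := by
    intro z
    let f := val₂ (cochain z)
    refine cls_eq_zero _ (mk₁ (fun x y => f x (x * d) (y * d) - f x y (y * d)) (by fun_prop) ?_) ?_
    · intro g x y
      simp only [mul_assoc, f, val₂_inv]
    · apply ext₂
      intro x y w
      rw [cochain_sub, d₁_apply]
      change val₂ (cochain (pullZ φ 2 z)) x y w - f x y w = (f y (y * d) (w * d) - f y w (w * d))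
        - ((f x (x * d) (w * d) - f x w (w * d)) - (f x (x * d) (y * d) - f x y (y * d)))
      rw [val₂_pullZ, hφ, hφ, hφ, mul_assoc, mul_assoc, mul_assoc, val₂_inv]
      have h1 := cocycle₂ z x (x * d) (y * d) (w * d)
      have h2 := cocycle₂ z x y (y * d) (w * d)
      have h3 := cocycle₂ z x y w (w * d)
      linear_combination h1 - h2 + h3
  have h : ContinuousCohomology.π (triv p G) 2 ≫ ContinuousCohomology.map φ (trivRes (p := p) φ) 2 =
      ContinuousCohomology.π (triv p G) 2 := by
    ext z
    have h0 := key z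
    rw [map_sub, sub_eq_zero, ← pull_cls] at h0
    exact h0
  have h' : ContinuousCohomology.map φ (trivRes (p := p) φ) 2 = 𝟙 _ := by
    rw [← cancel_epi (ContinuousCohomology.π (triv p G) 2), h, Category.comp_id]
  exact ConcreteCategory.congr_hom h' c

end Functoriality

section Action

variable (p : ℕ) {Γ : Type u} [Group Γ] [TopologicalSpace Γ] [IsTopologicalGroup Γ]
  (Δ : Subgroup Γ) [Δ.Normal]

variable {p} in
/-- The automorphism `x ↦ g⁻¹ x g` of the normal subgroup `Δ`. -/
def conjInv (g : Γ) : Δ →ₜ* Δ where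
  toMonoidHom := (MulAut.conjNormal g⁻¹ : Δ ≃* Δ).toMonoidHom
  continuous_toFun := by
    refine continuous_induced_rng.2 ?_
    change Continuous fun x : Δ => g⁻¹ * (x : Γ) * g⁻¹⁻¹
    fun_prop

theorem coe_conjInv (g : Γ) (x : Δ) : (conjInv Δ g x : Γ) = g⁻¹ * x * g := by
  change g⁻¹ * (x : Γ) * g⁻¹⁻¹ = _
  rw [inv_inv]

/-- The action of `Γ` on `H^2(Δ, 𝔽_p)` induced by conjugation: on homogeneous cochains
`(g · f)(x, y, z) = f (g⁻¹ x g, g⁻¹ y g, g⁻¹ z g)`. -/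
noncomputable def conjRep : Representation (ZMod p) Γ (H p Δ 2) where
  toFun g := pull (conjInv Δ g) 2
  map_one' := by
    have h : conjInv Δ (1 : Γ) = ContinuousMonoidHom.id Δ := by
      ext x
      simp [coe_conjInv]
    rw [h, pull_id]
    rfl
  map_mul' g g' := by
    have h : conjInv Δ (g * g') = (conjInv Δ g').comp (conjInv Δ g) := by
      ext x
      rw [coe_conjInv]
      change _ = (conjInv Δ g' (conjInv Δ g x) : Γ)
      rw [coe_conjInv, coe_conjInv]
      group
    rw [h, pull_comp]
    rfl

variable [CompactSpace Δ]

/-- The action of `Γ` on the decomposable part of `H^2(Δ, 𝔽_p)`. -/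
noncomputable def conjRepDec : Representation (ZMod p) Γ (dec p Δ) :=
  (conjRep p Δ).subrepresentation (dec p Δ) fun g => dec_le_comap_pull (conjInv Δ g)

instance : Representation.IsTrivial ((conjRepDec p Δ).comp Δ.subtype) where
  out d := by
    ext c
    refine pull_inner (conjInv Δ (d : Γ)) d (fun x => ?_) c.1
    ext
    simp [coe_conjInv]

/-- `H^2(Δ, 𝔽_p)^{dec}` as an `𝔽_p[Γ/Δ]`-module. -/
noncomputable def decRep : Representation (ZMod p) (Γ ⧸ Δ) (dec p Δ) :=
  (conjRepDec p Δ).ofQuotient Δ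

end Action

end ModPCohomology

section ProP

variable (p : ℕ) (Γ : Type*) [Group Γ] [TopologicalSpace Γ]

/-- A profinite group is pro-`p` if all its quotients by open normal subgroups are `p`-groups. -/
structure IsProP : Prop where
  compactSpace : CompactSpace Γ
  totallyDisconnectedSpace : TotallyDisconnectedSpace Γ
  isPGroup : ∀ U : OpenNormalSubgroup Γ, IsPGroup p (Γ ⧸ U.toSubgroup)

/-- The descending `p`-central series: `Γ^{(1)} = Γ`, and `Γ^{(n+1)}` is the closed subgroup
generated by the `p`-th powers of elements of `Γ^{(n)}` and the commutators `[Γ^{(n)}, Γ]`.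
(The index `0` is not used.) -/
def pCentralSeries [IsTopologicalGroup Γ] : ℕ → Subgroup Γ
  | 0 => ⊤
  | 1 => ⊤
  | n + 2 => (Subgroup.closure {x | ∃ y ∈ pCentralSeries (n + 1), y ^ p = x} ⊔
      ⁅pCentralSeries (n + 1), (⊤ : Subgroup Γ)⁆).topologicalClosure

variable {p Γ}

/-- A maximal closed subgroup: maximal among the proper closed subgroups. -/
structure IsMaximalClosed (Δ : Subgroup Γ) : Prop where
  isClosed : IsClosed (Δ : Set Γ)
  ne_top : Δ ≠ ⊤
  maximal : ∀ K : Subgroup Γ, IsClosed (K : Set Γ) → Δ ≤ K → K ≠ ⊤ → K = Δ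

theorem IsMaximalClosed.compactSpace {Δ : Subgroup Γ} (hΓ : IsProP p Γ)
    (hΔ : IsMaximalClosed Δ) : CompactSpace Δ :=
  have := hΓ.compactSpace
  isCompact_iff_compactSpace.1 hΔ.isClosed.isCompact

theorem IsMaximalClosed.normal [IsTopologicalGroup Γ] [Fact p.Prime] {Δ : Subgroup Γ}
    (hΓ : IsProP p Γ) (hΔ : IsMaximalClosed Δ) : Δ.Normal := by
  have := hΓ.compactSpace
  have := hΓ.totallyDisconnectedSpace
  -- `Δ` is open
  have hopen : IsOpen (Δ : Set Γ) := by
    have h := ProfiniteGrp.closedSubgroup_eq_sInf_open (⟨Δ, hΔ.isClosed⟩ : ClosedSubgroup Γ)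
    by_contra hno
    apply hΔ.ne_top
    change Δ = _ at h
    rw [h, sInf_eq_top]
    rintro K ⟨hK1, hK2⟩
    by_contra hK
    have := hΔ.maximal K (K.isClosed_of_isOpen hK1) hK2 hK
    exact hno (this ▸ hK1)
  have hfin : Finite (Γ ⧸ Δ) := Subgroup.quotient_finite_of_isOpen Δ hopen
  have hfi : Δ.FiniteIndex := Subgroup.finiteIndex_of_finite_quotient
  let U : OpenNormalSubgroup Γ :=
    { toSubgroup := Δ.normalCore
      isOpen' := Subgroup.isOpen_of_isClosed_of_finiteIndex _ (Δ.normalCore_isClosed hΔ.isClosed) }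
  let q : Γ →* Γ ⧸ U.toSubgroup := QuotientGroup.mk' U.toSubgroup
  have hq : Function.Surjective q := QuotientGroup.mk'_surjective _
  have hqk : q.ker ≤ Δ := (QuotientGroup.ker_mk' U.toSubgroup).le.trans Δ.normalCore_le
  have : Finite (Γ ⧸ U.toSubgroup) := Subgroup.quotient_finite_of_isOpen _ U.isOpen'
  have hnil : Group.IsNilpotent (Γ ⧸ U.toSubgroup) := (hΓ.isPGroup U).isNilpotent
  have hco : IsCoatom (Δ.map q) := by
    refine ⟨fun h => hΔ.ne_top ?_, fun K hK => ?_⟩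
    · rw [← Subgroup.comap_map_eq_self hqk, h, Subgroup.comap_top]
    · by_contra hne
      have hle : Δ ≤ K.comap q := Subgroup.map_le_iff_le_comap.1 hK.le
      have hop : IsOpen ((K.comap q : Subgroup Γ) : Set Γ) := Subgroup.isOpen_mono hle hopen
      have hne' : K.comap q ≠ ⊤ := fun h => hne (by
        rw [← Subgroup.map_comap_eq_self_of_surjective hq K, h,
          Subgroup.map_top_of_surjective q hq])
      have h := hΔ.maximal _ (Subgroup.isClosed_of_isOpen _ hop) hle hne'
      refine hK.not_ge ?_
      rw [← Subgroup.map_comap_eq_self_of_surjective hq K]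
      exact Subgroup.map_mono h.le
  have hn : (Δ.map q).Normal :=
    Subgroup.NormalizerCondition.normal_of_coatom _ Group.normalizerCondition_of_isNilpotent hco
  rw [← Subgroup.comap_map_eq_self hqk]
  exact hn.comap q

/-- The isomorphism `Γ/Δ ≃ H/N` induced by a surjection `α : Γ → H` with `α(Δ) = N` and
`ker α ⊆ Δ`. -/
noncomputable def quotientIso {Γ H : Type*} [Group Γ] [Group H] {Δ : Subgroup Γ} {N : Subgroup H}
    [Δ.Normal] [N.Normal] (α : Γ →* H) (hα : Function.Surjective α) (hN : Δ.map α = N)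
    (hker : α.ker ≤ Δ) : Γ ⧸ Δ ≃* H ⧸ N :=
  MulEquiv.ofBijective (QuotientGroup.map Δ N α (Subgroup.map_le_iff_le_comap.1 hN.le)) (by
    refine ⟨?_, QuotientGroup.map_surjective_of_surjective _ _ _
      ((QuotientGroup.mk'_surjective N).comp hα) _⟩
    rw [← MonoidHom.ker_eq_bot_iff, QuotientGroup.ker_map, ← hN,
      Subgroup.comap_map_eq_self hker, QuotientGroup.map_mk'_self])

end ProP

/-! Let `β : Δ → N` be the restriction of `α`; the isomorphism is inverse to inflation along `β`. A
1-cocycle is a homomorphism to `𝔽_p`, so it kills `Δ^{(2)} ⊇ ker β` and descends to `N`. Hence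
inflation is onto in degree 1 (`pull_one_surjective`) and, by naturality of cup products, onto the
decomposable classes.

Injectivity (`eq_zero_of_pull_eq_zero`) is where `Δ^{(3)}` enters. A sum of cup products `z`
vanishes when two successive arguments differ by an element of `N^{(2)}`. If `z` inflates to `df`
and `h = f(1, ·)`, then `h(x) + h(y) - h(xy) = z(1, β x, β (xy))`, so `h` is additive once either
argument lies in `Δ^{(2)}`. Such an `h` kills `p`-th powers of `Δ^{(2)}` and commutators `[Δ^{(2)},
Δ]`, hence `Δ^{(3)} ⊇ ker β`. So `f` descends to a cochain on `N` with coboundary `z`. -/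

namespace ModPCohomology

open CategoryTheory
open scoped commutatorElement

/-! ### Cochains and the descending `p`-central series -/

section Group

variable {p : ℕ} {G : Type u} [Group G] [TopologicalSpace G] [IsTopologicalGroup G]

/-- A cocycle whose class vanishes is a coboundary. -/
theorem exists_d_eq_of_cls_eq_zero {n : ℕ} (z : Z p G (n + 1)) (h : cls (n + 1) z = 0) :
    ∃ f : (cochains p G).X n, cochain z = ((cochains p G).d n (n + 1)).hom f := by
  let t := (cochains p G).toCycles n (n + 1)
  let hc := (cochains p G).homologyIsCokernel n (n + 1) (by simp)
  -- The concrete quotient by the range of `t` factors through homology, so a cocycle of zero class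
  -- dies there and lies in that range.
  have hfac : (cochains p G).homologyπ (n + 1) ≫
      hc.desc (Limits.CokernelCofork.ofπ (TopModuleCat.cokerπ t) (TopModuleCat.comp_cokerπ t)) =
        TopModuleCat.cokerπ t :=
    hc.fac _ Limits.WalkingParallelPair.one
  have h1 := ConcreteCategory.congr_hom hfac z
  have h2 : (TopModuleCat.cokerπ t).hom z = 0 := by
    refine h1.symm.trans ?_
    refine (congrArg _ h).trans ?_
    exact map_zero (ConcreteCategory.hom (hc.desc _))
  rw [TopModuleCat.hom_cokerπ, Submodule.mkQ_apply, Submodule.Quotient.mk_eq_zero] at h2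
  obtain ⟨f, hf⟩ := h2
  refine ⟨f, ?_⟩
  rw [← hf]
  exact ConcreteCategory.congr_hom ((cochains p G).toCycles_i n (n + 1)) f

/-- Passage from homogeneous to inhomogeneous cochains, used to treat `f` as a function of one
variable. -/
theorem val₁_eq (f : (cochains p G).X 1) (x y : G) : val₁ f x y = val₁ f 1 (x⁻¹ * y) := by
  rw [← val₁_inv f x⁻¹ x y, inv_mul_cancel]

/-- The homomorphism `G → 𝔽_p` given by a 1-cocycle. -/
noncomputable def toHom (z : Z p G 1) : G →* Multiplicative (Fp.{u} p) where
  toFun x := Multiplicative.ofAdd (val₁ (cochain z) 1 x)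
  map_one' := by
    have h := cocycle₁ z 1 1 1
    rw [left_eq_add] at h
    rw [h, ofAdd_zero]
  map_mul' x y := by
    rw [cocycle₁ z 1 x (x * y), val₁_eq _ x, inv_mul_cancel_left, ofAdd_add]

theorem nsmul_Fp_eq_zero (a : Fp.{u} p) : p • a = 0 := by
  ext
  simp

theorem continuous_toHom (z : Z p G 1) : Continuous fun x => val₁ (cochain z) 1 x :=
  (val₁ (cochain z) 1).continuous

/-- A 1-cocycle vanishes on the second term of the descending `p`-central series. -/
theorem val₁_eq_zero_of_mem (z : Z p G 1) {k : G} (hk : k ∈ pCentralSeries p G 2) :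
    val₁ (cochain z) 1 k = 0 := by
  have hle : pCentralSeries p G 2 ≤ (toHom z).ker := by
    refine Subgroup.topologicalClosure_minimal _ (sup_le ?_ ?_) ?_
    · rw [Subgroup.closure_le]
      rintro _ ⟨y, -, rfl⟩
      change toHom z (y ^ p) = 1
      rw [map_pow]
      exact nsmul_Fp_eq_zero (p := p) (val₁ (cochain z) 1 y)
    · rw [Subgroup.commutator_le]
      intro x _ y _
      rw [MonoidHom.mem_ker, map_commutatorElement, commutatorElement_eq_one_iff_mul_comm, mul_comm]
    · exact isClosed_singleton.preimage (continuous_toHom z)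
  exact hle hk

theorem pCentralSeries_three_le : pCentralSeries p G 3 ≤ pCentralSeries p G 2 := by
  refine Subgroup.topologicalClosure_mono (sup_le_sup (Subgroup.closure_mono ?_)
    (Subgroup.commutator_mono le_top le_rfl))
  rintro _ ⟨y, -, rfl⟩
  exact ⟨y, Subgroup.mem_top y, rfl⟩

/-- A continuous function that is additive as soon as one argument lies in the second term of the
descending `p`-central series vanishes on the third term. -/
theorem eq_zero_of_mem_pCentralSeries_three (h : G → Fp.{u} p) (hc : Continuous h)
    (hl : ∀ k ∈ pCentralSeries p G 2, ∀ x, h (k * x) = h k + h x)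
    (hr : ∀ k ∈ pCentralSeries p G 2, ∀ x, h (x * k) = h x + h k)
    {k : G} (hk : k ∈ pCentralSeries p G 3) : h k = 0 := by
  have h1 : h 1 = 0 := by simpa using hl 1 (one_mem _) 1
  -- The zero set of `h` alone need not be a subgroup; inside the second term `h` is additive.
  let S : Subgroup G :=
    { carrier := {k | k ∈ pCentralSeries p G 2 ∧ h k = 0}
      one_mem' := ⟨one_mem _, h1⟩
      mul_mem' := fun {a b} ha hb => ⟨mul_mem ha.1 hb.1, by rw [hl a ha.1, ha.2, hb.2, add_zero]⟩
      inv_mem' := fun {a} ha => ⟨inv_mem ha.1, by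
        have := hl a ha.1 a⁻¹
        rwa [mul_inv_cancel, h1, ha.2, zero_add, eq_comm] at this⟩ }
  have hle : pCentralSeries p G 3 ≤ S := by
    refine Subgroup.topologicalClosure_minimal _ (sup_le ?_ ?_) ?_
    · rw [Subgroup.closure_le]
      rintro _ ⟨y, hy, rfl⟩
      refine ⟨pow_mem hy p, ?_⟩
      have hpow : ∀ n : ℕ, h (y ^ n) = n • h y := by
        intro n
        induction n with
        | zero => rw [pow_zero, h1, zero_smul]
        | succ n ih => rw [pow_succ, hr y hy, ih, succ_nsmul]
      rw [hpow, nsmul_Fp_eq_zero]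
    · rw [Subgroup.commutator_le]
      intro y hy g _
      have hm : ⁅y, g⁆ ∈ pCentralSeries p G 2 :=
        Subgroup.le_topologicalClosure _ (Subgroup.mem_sup_right
          (Subgroup.commutator_mem_commutator (Subgroup.mem_top y) (Subgroup.mem_top g)))
      refine ⟨hm, ?_⟩
      -- Since `⁅y, g⁆ * (g * y) = y * g`, and `h` takes the value `h y + h g` on both `g * y` and
      -- `y * g`, it vanishes on the commutator.
      have e := hl _ hm (g * y)
      rw [commutatorElement_def, show y * g * y⁻¹ * g⁻¹ * (g * y) = y * g by group, hl y hy,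
        hr y hy, add_comm (h g), right_eq_add] at e
      exact e
    · exact (Subgroup.isClosed_topologicalClosure _).inter (isClosed_singleton.preimage hc)
  exact (hle hk).2

end Group

/-! ### Inflation along a surjection -/

section Surjection

variable {p : ℕ} {D N : Type u}
  [Group D] [TopologicalSpace D] [IsTopologicalGroup D] [CompactSpace D]
  [Group N] [TopologicalSpace N] [IsTopologicalGroup N] [CompactSpace N] [T2Space N]
  (β : D →ₜ* N) (hβ : Function.Surjective β)

omit [CompactSpace N] in
include hβ in
/-- A homogeneous 1-cochain of `D` that is constant on the cosets of the kernel of `β` comes from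
a 1-cochain of `N`. -/
theorem exists_descent₁ (f : (cochains p D).X 1)
    (hf : ∀ x k, β k = 1 → val₁ f 1 (x * k) = val₁ f 1 x) :
    ∃ f' : (cochains p N).X 1, ∀ x y, val₁ f' (β x) (β y) = val₁ f x y := by
  have hlift : ∀ x y, β x = β y → val₁ f 1 x = val₁ f 1 y := by
    intro x y hxy
    have := hf y (y⁻¹ * x) (by rw [map_mul, map_inv, hxy, inv_mul_cancel])
    rwa [mul_inv_cancel_left] at this
  let h' : N → Fp.{u} p := fun n => val₁ f 1 (Function.surjInv hβ n)
  have hh' : ∀ x, h' (β x) = val₁ f 1 x := fun x => hlift _ _ (Function.surjInv_eq hβ (β x))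
  -- The chosen section need not be continuous; continuity of `h'` comes from `β` being a quotient
  -- map, as a continuous surjection from a compact to a Hausdorff space.
  have hq : Topology.IsQuotientMap β :=
    .of_surjective_continuous hβ (map_continuous β)
  have hc : Continuous h' := by
    rw [hq.continuous_iff]
    exact (val₁ f 1).continuous.congr fun x => (hh' x).symm
  refine ⟨mk₁ (fun x y => h' (x⁻¹ * y)) (by fun_prop) fun g x y => by congr 1; group, fun x y => ?_⟩
  change h' ((β x)⁻¹ * β y) = _
  rw [← map_inv, ← map_mul, hh', ← val₁_eq]

omit [CompactSpace N] in
include hβ in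
theorem pull_one_surjective (hker : ∀ k, β k = 1 → k ∈ pCentralSeries p D 2) :
    Function.Surjective (pull (p := p) β 1) := by
  intro a
  obtain ⟨f', hf'⟩ := exists_descent₁ β hβ (cochain (rep₁ a)) fun x k hk => by
    rw [cocycle₁ _ 1 x, val₁_eq _ x, inv_mul_cancel_left, val₁_eq_zero_of_mem _ (hker k hk),
      add_zero]
  have hd : ((cochains p N).d 1 2).hom f' = 0 := by
    apply ext₂
    intro x y w
    obtain ⟨x, rfl⟩ := hβ x
    obtain ⟨y, rfl⟩ := hβ y
    obtain ⟨w, rfl⟩ := hβ w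
    rw [d₁_apply, hf', hf', hf', cocycle₁ _ x y w]
    change _ = (0 : Fp.{u} p)
    ring
  refine ⟨cls 1 (mkZ f' hd), ?_⟩
  rw [pull_cls, ← cls_rep₁ a]
  congr 1
  apply cochain_injective
  refine Subtype.ext (ContinuousMap.ext fun x => ContinuousMap.ext fun y => ?_)
  refine (val₁_pullZ β _ x y).trans ?_
  rw [cochain_mkZ]
  exact hf' x y

omit [T2Space N] in
/-- A decomposable class is represented by a cocycle that vanishes if two successive arguments
differ by an element of the second term of the descending `p`-central series. -/
theorem exists_rep_of_mem_dec {c : H p N 2} (hc : c ∈ dec p N) :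
    ∃ z : Z p N 2, cls 2 z = c ∧ ∀ x y k, k ∈ pCentralSeries p N 2 →
      val₂ (cochain z) 1 k x = 0 ∧ val₂ (cochain z) x y (y * k) = 0 := by
  -- The vanishing condition is linear in `z`, so cup products suffice: there one factor is the
  -- value of a homomorphism at `k`.
  induction hc using Submodule.span_induction with
  | mem c hc =>
    obtain ⟨a, b, rfl⟩ := hc
    refine ⟨cupZ (rep₁ a) (rep₁ b), rfl, fun x y k hk => ?_⟩
    rw [val₂_cupZ, val₂_cupZ, val₁_eq _ y, inv_mul_cancel_left, val₁_eq_zero_of_mem _ hk,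
      val₁_eq_zero_of_mem _ hk, zero_mul, mul_zero]
    exact ⟨rfl, rfl⟩
  | zero =>
    refine ⟨0, map_zero _, fun x y k _ => ?_⟩
    have h0 : cochain (0 : Z p N 2) = 0 := map_zero ((cochains p N).iCycles 2).hom
    rw [h0]
    exact ⟨rfl, rfl⟩
  | add c c' _ _ ih ih' =>
    obtain ⟨z, rfl, hz⟩ := ih
    obtain ⟨z', rfl, hz'⟩ := ih'
    refine ⟨z + z', map_add _ _ _, fun x y k hk => ?_⟩
    rw [cochain_add, val₂_add, val₂_add, (hz x y k hk).1, (hz x y k hk).2, (hz' x y k hk).1,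
      (hz' x y k hk).2, add_zero]
    exact ⟨rfl, rfl⟩
  | smul r c _ ih =>
    obtain ⟨z, rfl, hz⟩ := ih
    refine ⟨r • z, map_smul _ _ _, fun x y k hk => ?_⟩
    rw [cochain_smul, val₂_smul, val₂_smul, (hz x y k hk).1, (hz x y k hk).2, smul_zero]
    exact ⟨rfl, rfl⟩

-- Transfers the vanishing of a representative on `N` to its inflation to `D`.
omit [CompactSpace D] [CompactSpace N] [T2Space N] in
theorem map_mem_pCentralSeries_two {k : D} (hk : k ∈ pCentralSeries p D 2) :
    β k ∈ pCentralSeries p N 2 := by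
  have hle : pCentralSeries p D 2 ≤ (pCentralSeries p N 2).comap (β : D →* N) := by
    refine Subgroup.topologicalClosure_minimal _ (sup_le ?_ ?_) ?_
    · rw [Subgroup.closure_le]
      rintro _ ⟨y, -, rfl⟩
      exact Subgroup.le_topologicalClosure _ (Subgroup.mem_sup_left
        (Subgroup.subset_closure ⟨β y, Subgroup.mem_top _, (map_pow β y p).symm⟩))
    · rw [Subgroup.commutator_le]
      intro x _ y _
      refine Subgroup.le_topologicalClosure _ (Subgroup.mem_sup_right ?_)
      rw [map_commutatorElement]
      exact Subgroup.commutator_mem_commutator (Subgroup.mem_top _) (Subgroup.mem_top _)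
    · exact (Subgroup.isClosed_topologicalClosure _).preimage (map_continuous β)
  exact hle hk

include hβ in
/-- If the kernel of `β` lies in the third term of the descending `p`-central series, then
inflation along `β` is injective on decomposable classes. -/
theorem eq_zero_of_pull_eq_zero (hker : ∀ k, β k = 1 → k ∈ pCentralSeries p D 3) {c : H p N 2}
    (hc : c ∈ dec p N) (h0 : pull β 2 c = 0) : c = 0 := by
  obtain ⟨z, rfl, hz⟩ := exists_rep_of_mem_dec hc
  rw [pull_cls] at h0
  obtain ⟨f, hf⟩ := exists_d_eq_of_cls_eq_zero _ h0
  have hd : ∀ x y w, val₂ (cochain z) (β x) (β y) (β w) =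
      val₁ f y w - (val₁ f x w - val₁ f x y) := fun x y w => by
    rw [← val₂_pullZ, hf, d₁_apply]
  have hl : ∀ k ∈ pCentralSeries p D 2, ∀ x, val₁ f 1 (k * x) = val₁ f 1 k + val₁ f 1 x := by
    intro k hk x
    have h := hd 1 k (k * x)
    rw [map_one, (hz _ 1 _ (map_mem_pCentralSeries_two β hk)).1, val₁_eq f k,
      inv_mul_cancel_left] at h
    linear_combination h
  have hr : ∀ k ∈ pCentralSeries p D 2, ∀ x, val₁ f 1 (x * k) = val₁ f 1 x + val₁ f 1 k := by
    intro k hk x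
    have h := hd 1 x (x * k)
    rw [map_mul, (hz _ _ _ (map_mem_pCentralSeries_two β hk)).2, val₁_eq f x,
      inv_mul_cancel_left] at h
    linear_combination h
  -- Additivity needs `k` only in the second term; `h k = 0` needs the third.
  obtain ⟨f', hf'⟩ := exists_descent₁ β hβ f fun x k hk => by
    rw [hr k (pCentralSeries_three_le (hker k hk)),
      eq_zero_of_mem_pCentralSeries_three _ (val₁ f 1).continuous hl hr (hker k hk), add_zero]
  refine cls_eq_zero z f' (ext₂ fun x y w => ?_)
  obtain ⟨x, rfl⟩ := hβ x
  obtain ⟨y, rfl⟩ := hβ y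
  obtain ⟨w, rfl⟩ := hβ w
  rw [hd, d₁_apply, hf', hf', hf']

/-- Inflation of decomposable classes along `β`. -/
noncomputable def pullDec : dec p N →ₗ[ZMod p] dec p D :=
  (pull β 2).restrict (dec_le_comap_pull β)

include hβ in
theorem pullDec_bijective (hker : ∀ k, β k = 1 → k ∈ pCentralSeries p D 3) :
    Function.Bijective (pullDec (p := p) β) := by
  constructor
  · rw [injective_iff_map_eq_zero]
    intro c hc
    exact Subtype.ext (eq_zero_of_pull_eq_zero β hβ hker c.2 congr(($hc).1))
  · have hle : dec p D ≤ (dec p N).map (pull β 2) := by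
      refine Submodule.span_le.2 ?_
      rintro _ ⟨a, b, rfl⟩
      have hs := pull_one_surjective (p := p) β hβ fun k hk => pCentralSeries_three_le (hker k hk)
      obtain ⟨a, rfl⟩ := hs a
      obtain ⟨b, rfl⟩ := hs b
      exact ⟨cup a b, Submodule.subset_span ⟨a, b, rfl⟩, pull_cup β a b⟩
    rintro ⟨c, hc⟩
    obtain ⟨c', hc', h⟩ := hle hc
    exact ⟨⟨c', hc'⟩, Subtype.ext h⟩

end Surjection

/-! ### Compatibility with conjugation -/

section Equivariance

variable {p : ℕ} {Γ H : Type u} [Group Γ] [TopologicalSpace Γ] [IsTopologicalGroup Γ]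
  [Group H] [TopologicalSpace H] [IsTopologicalGroup H]
  {Δ : Subgroup Γ} {N : Subgroup H}

/-- The restriction of a continuous homomorphism to subgroups. -/
def restrictHom (α : Γ →ₜ* H) (h : Δ ≤ N.comap (α : Γ →* H)) : Δ →ₜ* N where
  toFun x := ⟨α x, h x.2⟩
  map_one' := Subtype.ext (map_one α)
  map_mul' x y := Subtype.ext (map_mul α (x : Γ) y)
  continuous_toFun := ((map_continuous α).comp continuous_subtype_val).subtype_mk _

/-- Inflation is equivariant for the actions by conjugation. -/
theorem pullDec_conjRepDec [Δ.Normal] [N.Normal] [CompactSpace Δ] [CompactSpace N]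
    (α : Γ →ₜ* H) (h : Δ ≤ N.comap (α : Γ →* H)) (g : Γ) (c : dec p N) :
    pullDec (restrictHom α h) (conjRepDec p N (α g) c) =
      conjRepDec p Δ g (pullDec (restrictHom α h) c) := by
  have hcomm : (conjInv N (α g)).comp (restrictHom α h) =
      (restrictHom α h).comp (conjInv Δ g) := by
    ext x
    change (conjInv N (α g) (restrictHom α h x) : H) = α (conjInv Δ g x : Γ)
    rw [coe_conjInv, coe_conjInv, map_mul, map_mul, map_inv]
    rfl
  apply Subtype.ext
  change pull (restrictHom α h) 2 (pull (conjInv N (α g)) 2 c.1) =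
    pull (conjInv Δ g) 2 (pull (restrictHom α h) 2 c.1)
  rw [← LinearMap.comp_apply, ← pull_comp, hcomm, pull_comp, LinearMap.comp_apply]

end Equivariance

end ModPCohomology

open ModPCohomology in
theorem mainTheorem11 (p : ℕ) [Fact p.Prime]
    {Γ H : Type u} [Group Γ] [TopologicalSpace Γ] [IsTopologicalGroup Γ]
    [Group H] [TopologicalSpace H] [IsTopologicalGroup H]
    (hΓ : IsProP p Γ) (hH : IsProP p H)
    (Δ : Subgroup Γ) (N : Subgroup H) (hΔ : IsMaximalClosed Δ) (hN : IsMaximalClosed N)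
    (α : Γ →ₜ* H) (hα : Function.Surjective α)
    (hαΔ : Δ.map (α : Γ →* H) = N)
    (hker : (α : Γ →* H).ker ≤ (pCentralSeries p Δ 3).map Δ.subtype) :
    haveI : Δ.Normal := hΔ.normal hΓ
    haveI : N.Normal := hN.normal hH
    haveI : CompactSpace Δ := hΔ.compactSpace hΓ
    haveI : CompactSpace N := hN.compactSpace hH
    Nonempty (Representation.Equiv (ModPCohomology.decRep p Δ)
      ((ModPCohomology.decRep p N).comp
        (quotientIso (α : Γ →* H) hα hαΔ (hker.trans (Subgroup.map_subtype_le _)) :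
          Γ ⧸ Δ →* H ⧸ N))) := by
  have : Δ.Normal := hΔ.normal hΓ
  have : N.Normal := hN.normal hH
  have : CompactSpace Δ := hΔ.compactSpace hΓ
  have : CompactSpace N := hN.compactSpace hH
  -- Supplies the Hausdorff property of `N` needed for descent.
  have := hH.totallyDisconnectedSpace
  have hle : Δ ≤ N.comap (α : Γ →* H) := Subgroup.map_le_iff_le_comap.1 hαΔ.le
  have hsurj : Function.Surjective (restrictHom α hle) := by
    rintro ⟨n, hn⟩
    rw [← hαΔ] at hn
    obtain ⟨x, hx, rfl⟩ := hn
    exact ⟨⟨x, hx⟩, rfl⟩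
  have hker' : ∀ k, restrictHom α hle k = 1 → k ∈ pCentralSeries p Δ 3 := by
    intro k hk
    obtain ⟨k', hk', h⟩ := hker (x := (k : Γ)) congr(($hk).1)
    rwa [← Subtype.ext h]
  let e := LinearEquiv.ofBijective (pullDec (p := p) (restrictHom α hle))
    (pullDec_bijective _ hsurj hker')
  -- Inflation runs from `N` to `Δ`, opposite to the required direction.
  refine ⟨Representation.Equiv.mk e.symm fun g => ?_⟩
  obtain ⟨g, rfl⟩ := QuotientGroup.mk_surjective g
  ext1 c
  obtain ⟨c, rfl⟩ := e.surjective c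
  -- On a representative `g`, the quotient actions unfold to conjugation by `g` and by `α g`.
  change e.symm (conjRepDec p Δ g (e c)) = conjRepDec p N (α g) (e.symm (e c))
  rw [e.symm_apply_apply, e.symm_apply_eq]
  exact (pullDec_conjRepDec α hle g c).symm
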